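/- Definitions. Let $C\subseteq\{0,1\}^d$ be a finite vocabulary with at least two tokens. An input of the general associative recall (GAR) problem is a sequence of $N=2n+m$ tokens of $C$, $$u=(k_0,v_0),\ldots,(k_{n-1},v_{n-1});\,q_0,\ldots,q_{m-1},\qquad u\in\{0,1\}^{N\times d},$$ with set of keys $A=\{k_0,\ldots,k_{n-1}\}$ and set of queries $B=\{q_0,\ldots,q_{m-1}\}$. A correct answer to the query $q_j$ is a value $v_i$ with $k_i=q_j$ if some key equals $q_j$, and $\mathtt{Null}$ otherwise. For $p\ge 1$, the $p$-fold repeated prompt of $u$ is $u^{(p)}\in\{0,1\}^{pN\times d}$ with rows $u^{(p)}[i]=u[i \bmod N]$. A recurrent model for inputs of length $T$ consists of a fixed initial state $Z^0\in\mathbb R^{D}$ and arbitrary maps $f^i:\mathbb R^D\times\mathbb R^d\to\mathbb R^D$, $0\le i<T$; on an input $w\in\mathbb R^{T\times d}$ its states are $Z^{i+1}(w)=f^i(Z^i(w),w[i])$. For integers $a,b$, a recurrent model for inputs of length $pN$ solves GAR on the inputs with $|A|=a$ and $|B|=b$ if for every such input $u$ a correct answer to every query is determined by the queries together with the states on $u^{(p)}$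 right after the query locations (in all copies of $u$). The states are stored as bit strings: for each location $1\le i\le pN$, the states $Z^i(u^{(p)})$ reached on these inputs are represented by bit strings, with different strings for different states, and $|Z^i(u^{(p)})|$ is the length of the string in bits. Proposition. There is an absolute constant $\kappa>0$ such that the following holds for all $p\ge 1$, all $n,m,d,D$, every such vocabulary $C$, and all integers $0\le a\le\min\{n,|C|\}$, $0\le b\le\min\{m,|C|\}$. Let a recurrent model with states in $\mathbb R^D$, run on the $p$-fold repeated prompts $u^{(p)}$, solve GAR on all inputs $u$ with $n$ key-value pairs, $m$ queries, $|A|=a$ and $|B|=b$. Then, for every representation of its states by bit strings, the worst-case state size over these inputs and all locations satisfies $$\max_{u}\,\max_{1\le i\le pN}|Z^i(u^{(p)})|\;\ge\;\kappa\cdot\frac{\min\{a,b\}}{p}\ \text{ bits},$$ where the maximum is read as $0$ if it is over an empty set. That is, the state size is $\Omega(\min\{|A|,|B|\}/p)$ bits. -/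

import Mathlib

/-- A recurrent model for inputs with `T` rows in `ℝ^d` and states in `ℝ^D`: an initial state
(independent of the input) and, for every location `i`, an arbitrary update map `f^i`, which
computes the new state from the previous state and the current row. -/
structure RecurrentModel (T d D : ℕ) where
  init : Fin D → ℝ
  step : Fin T → (Fin D → ℝ) → (Fin d → ℝ) → (Fin D → ℝ)

/-- The states of a recurrent model on the input `u`: `Z^0` is the initial state and
`Z^(i+1) = f^i (Z^i, u[i])`. Thus `Z^i` is a function of `u[0], …, u[i-1]`. -/
def RecurrentModel.state {T d D : ℕ} (M : RecurrentModel T d D)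
    (u : Matrix (Fin T) (Fin d) ℝ) : Fin (T + 1) → (Fin D → ℝ) :=
  Fin.induction M.init (fun i z => M.step i z (u i))

/-- An input of the general associative recall problem over the vocabulary `C`: `n` key-value
pairs and `m` queries, all of them tokens of `C`. -/
structure GARInput {d : ℕ} (C : Finset (Fin d → ℝ)) (n m : ℕ) where
  key : Fin n → C
  value : Fin n → C
  query : Fin m → C

namespace GARInput

variable {d : ℕ} {C : Finset (Fin d → ℝ)} {n m : ℕ}

/-- The set `A` of keys that occur in the input. -/
def keySet (x : GARInput C n m) : Set C := Set.range x.key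

/-- The set `B` of queries that occur in the input. -/
def querySet (x : GARInput C n m) : Set C := Set.range x.query

/-- The input written as a sequence of `N = 2n + m` rows
`k_0, v_0, …, k_(n-1), v_(n-1), q_0, …, q_(m-1)`. -/
def toMatrix (x : GARInput C n m) : Matrix (Fin (2 * n + m)) (Fin d) ℝ := fun i =>
  if h : i.val < 2 * n then
    if i.val % 2 = 0 then (x.key ⟨i.val / 2, by omega⟩ : Fin d → ℝ)
    else (x.value ⟨i.val / 2, by omega⟩ : Fin d → ℝ)
  else (x.query ⟨i.val - 2 * n, by omega⟩ : Fin d → ℝ)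

/-- `o` is a correct answer to the query `q`: either a value paired with a key equal to `q`, or
`none` (the symbol Null) in case no key equals `q`. -/
def IsAnswer (x : GARInput C n m) (q : C) : Option C → Prop
  | some v => ∃ i, x.key i = q ∧ x.value i = v
  | none => ∀ i, x.key i ≠ q

end GARInput

/-- The input `u` repeated `p` times: row `i` of the prompt is `u[i mod N]`. -/
def jrpPrompt {N d : ℕ} (p : ℕ) (u : Matrix (Fin N) (Fin d) ℝ) :
    Matrix (Fin (p * N)) (Fin d) ℝ :=
  fun i => u i.modNat

/-- The location of the `j`-th query in the `r`-th copy of the input, i.e. `r * N + 2 * n + j`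
with `N = 2 * n + m`. -/
def queryLocation {p n m : ℕ} (r : Fin p) (j : Fin m) : Fin (p * (2 * n + m)) :=
  finProdFinEquiv (r, Fin.natAdd (2 * n) j)

/-- The inputs with `n` key-value pairs, `m` queries, exactly `a` different keys and exactly `b`
different queries. -/
def garInputs {d : ℕ} (C : Finset (Fin d → ℝ)) (n m a b : ℕ) : Set (GARInput C n m) :=
  {x | x.keySet.ncard = a ∧ x.querySet.ncard = b}

namespace RecurrentModel

variable {p n m d D : ℕ}

/-- The model, run on `p`-fold repeated inputs, solves general associative recall on all inputs
with `|A| = a` and `|B| = b`: a correct answer to each query can be read off from the states right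
after the query locations, together with the queries themselves. This covers a model that answers
a query when it reaches the query in any one of the copies, and also a model that answers all
queries from its last state. -/
def SolvesGAR (M : RecurrentModel (p * (2 * n + m)) d D) (C : Finset (Fin d → ℝ))
    (a b : ℕ) : Prop :=
  ∃ readout : (Fin p → Fin m → (Fin D → ℝ)) → (Fin m → C) → Fin m → Option C,
    ∀ x ∈ garInputs C n m a b, ∀ j : Fin m,
      x.IsAnswer (x.query j)
        (readout (fun r t => M.state (jrpPrompt p x.toMatrix) (queryLocation r t).succ)
          x.query j)

/-- `enc` is a representation of the states by bit strings, which may depend on the location: at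
every location it distinguishes the states that the model reaches there. -/
def IsBitRepresentation (M : RecurrentModel (p * (2 * n + m)) d D) (C : Finset (Fin d → ℝ))
    (a b : ℕ) (enc : Fin (p * (2 * n + m)) → (Fin D → ℝ) → List Bool) : Prop :=
  ∀ i, Set.InjOn (enc i)
    ((fun x : GARInput C n m => M.state (jrpPrompt p x.toMatrix) i.succ) '' garInputs C n m a b)

/-- All states that the model reaches on these prompts take at most `L` bits, i.e.
`max_i |Z^i| ≤ L`. -/
def StateBitsLE (M : RecurrentModel (p * (2 * n + m)) d D) (C : Finset (Fin d → ℝ))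
    (a b : ℕ) (enc : Fin (p * (2 * n + m)) → (Fin D → ℝ) → List Bool) (L : ℕ) : Prop :=
  ∀ x ∈ garInputs C n m a b, ∀ i,
    (enc i (M.state (jrpPrompt p x.toMatrix) i.succ)).length ≤ L

end RecurrentModel

/-! A counting argument over the values. Fix the keys and queries so that `min a b` distinct tokens
occur among both, and let the value paired with each of these tokens encode a free bit. The queries
are common to all these inputs, so in each copy the state just before the queries determines every
later query state (`state_queryLocation_eq`). The `p` states at these boundaries therefore fix all
answers, and the answers give back the bits (`bit_eq_of_isAnswer`). Hence `2 ^ min a b` inputs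
inject into `p`-tuples of strings of length at most `L`, of which there are at most `2 ^ (2 * L *
p)`. -/

namespace RecurrentModel

theorem state_succ {T d D : ℕ} (M : RecurrentModel T d D) (u : Matrix (Fin T) (Fin d) ℝ)
    (i : Fin T) : M.state u i.succ = M.step i (M.state u i.castSucc) (u i) := by
  simp [state]

/-- Two runs that agree at location `s` and read the same rows from `s` on up to `s + t` agree
at location `s + t`. -/
theorem state_eq_of_rows_eq {T d D : ℕ} (M : RecurrentModel T d D)
    {u w : Matrix (Fin T) (Fin d) ℝ} {s : ℕ} (hs : s < T + 1)
    (h : M.state u ⟨s, hs⟩ = M.state w ⟨s, hs⟩) (t : ℕ) (ht : s + t < T + 1)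
    (hrow : ∀ i : Fin T, s ≤ i.val → i.val < s + t → u i = w i) :
    M.state u ⟨s + t, ht⟩ = M.state w ⟨s + t, ht⟩ := by
  induction t with
  | zero => exact h
  | succ t ih =>
    have ih' := ih (by omega) fun i h₁ h₂ => hrow i h₁ (by omega)
    have hi : s + t < T := by omega
    have hu := M.state_succ u ⟨s + t, hi⟩
    have hw := M.state_succ w ⟨s + t, hi⟩
    rw [hrow ⟨s + t, hi⟩ (by simp) (by simp)] at hu
    exact hu.trans ((congrArg (fun z => M.step ⟨s + t, hi⟩ z (w ⟨s + t, hi⟩)) ih').trans hw.symm)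

end RecurrentModel

/-- The location of the last value in the `r`-th copy of the input. -/
def lastValueLocation {p n m : ℕ} (hn : 0 < n) (r : Fin p) : Fin (p * (2 * n + m)) :=
  finProdFinEquiv (r, ⟨2 * n - 1, by omega⟩)

/-- If two inputs have the same queries, then the state at the end of the key-value part of a copy
determines the states at all query locations of that copy. -/
theorem RecurrentModel.state_queryLocation_eq {p n m d D : ℕ} {C : Finset (Fin d → ℝ)}
    (M : RecurrentModel (p * (2 * n + m)) d D) (hn : 0 < n) {x y : GARInput C n m}
    (hq : x.query = y.query) (r : Fin p)
    (h : M.state (jrpPrompt p x.toMatrix) (lastValueLocation hn r).succ =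
      M.state (jrpPrompt p y.toMatrix) (lastValueLocation hn r).succ) (t : Fin m) :
    M.state (jrpPrompt p x.toMatrix) (queryLocation r t).succ =
      M.state (jrpPrompt p y.toMatrix) (queryLocation r t).succ := by
  have hs : (lastValueLocation (m := m) hn r).succ.val + (t.val + 1) =
      (queryLocation (n := n) r t).succ.val := by
    simp [lastValueLocation, queryLocation, finProdFinEquiv]
    omega
  have key := M.state_eq_of_rows_eq (lastValueLocation (m := m) hn r).succ.isLt h (t.val + 1)
    (hs ▸ (queryLocation (n := n) r t).succ.isLt) fun i h₁ h₂ => by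
      -- As `t < m`, these rows stay inside copy `r`, at offsets `≥ 2 * n`: only queries are read.
      have hN : i.val % (2 * n + m) = i.val - (2 * n + m) * r.val ∧
          2 * n ≤ i.val - (2 * n + m) * r.val := by
        simp only [lastValueLocation, finProdFinEquiv, Equiv.coe_fn_mk, Fin.val_succ] at h₁ h₂
        have ht := t.isLt
        refine ⟨?_, by omega⟩
        have hi : i.val = (i.val - (2 * n + m) * r.val) + (2 * n + m) * r.val := by omega
        rw [hi, Nat.add_mul_mod_self_left, Nat.mod_eq_of_lt (by omega)]
        omega
      have hlt : ¬ (i.modNat : Fin (2 * n + m)).val < 2 * n := by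
        rw [Fin.coe_modNat, hN.1]
        exact not_lt.mpr hN.2
      simp only [jrpPrompt, GARInput.toMatrix, dif_neg hlt, hq]
  have e : (⟨_, hs ▸ (queryLocation (n := n) r t).succ.isLt⟩ : Fin (p * (2 * n + m) + 1)) =
      (queryLocation r t).succ := Fin.ext hs
  rwa [e] at key

/-- Clamping the index at `a - 1` repeats the last token, filling the `k` slots without adding new
tokens. -/
theorem ncard_range_comp_min {α : Type*} {k a N : ℕ} (e : Fin N ↪ α) (ha : 0 < a)
    (hak : a ≤ k) (haN : a ≤ N) :
    (Set.range fun i : Fin k => e ⟨min i.val (a - 1), by omega⟩).ncard = a := by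
  have h : (Set.range fun i : Fin k => e ⟨min i.val (a - 1), by omega⟩) =
      Set.range fun i : Fin a => e ⟨i.val, by omega⟩ := by
    ext z
    constructor
    · rintro ⟨i, rfl⟩
      exact ⟨⟨min i.val (a - 1), by omega⟩, rfl⟩
    · rintro ⟨i, rfl⟩
      refine ⟨⟨i.val, by omega⟩, ?_⟩
      have : min i.val (a - 1) = i.val := by omega
      simp [this]
  rw [h, ← Set.image_univ, Set.ncard_image_of_injective]
  · simp
  · intro i j hij
    exact Fin.ext (by simpa using hij)

/-- Keys and queries run through initial segments of an enumeration `e` of the vocabulary, and the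
values paired with the `i`-th key encode the bit `f i`. -/
def bitInput {d : ℕ} {C : Finset (Fin d → ℝ)} {N n m : ℕ} (e : Fin N ↪ C) (hN : 2 ≤ N) {a b : ℕ}
    (ha : 0 < a) (hb : 0 < b) (haN : a ≤ N) (hbN : b ≤ N) (f : ℕ → Bool) : GARInput C n m where
  key i := e ⟨min i.val (a - 1), by omega⟩
  value i := if f (min i.val (a - 1)) then e ⟨1, by omega⟩ else e ⟨0, by omega⟩
  query j := e ⟨min j.val (b - 1), by omega⟩

/-- A repeated key could allow several correct answers, but here the value depends only on the
clamped index, hence only on the key. -/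
theorem bit_eq_of_isAnswer {d : ℕ} {C : Finset (Fin d → ℝ)} {N n m : ℕ} (e : Fin N ↪ C)
    (hN : 2 ≤ N) {a b : ℕ} (ha : 0 < a) (hb : 0 < b) (haN : a ≤ N) (hbN : b ≤ N) (han : a ≤ n)
    {f g : ℕ → Bool} {j : ℕ} (hj : j < a) {o : Option C}
    (hf : (bitInput (n := n) (m := m) e hN ha hb haN hbN f).IsAnswer (e ⟨j, by omega⟩) o)
    (hg : (bitInput (n := n) (m := m) e hN ha hb haN hbN g).IsAnswer (e ⟨j, by omega⟩) o) :
    f j = g j := by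
  cases o with
  | none =>
    refine absurd ?_ (hf ⟨j, by omega⟩)
    have : min j (a - 1) = j := by omega
    simp [bitInput, this]
  | some v =>
    obtain ⟨i, hi, rfl⟩ := hf
    obtain ⟨i', hi', hv⟩ := hg
    simp only [bitInput, EmbeddingLike.apply_eq_iff_eq, Fin.mk.injEq] at hi hi' hv
    rw [hi, hi'] at hv
    cases hfj : f j <;> cases hgj : g j <;> simp_all

/-- The count is `2 ^ (L + 1) - 1`, and `2 * 2 ^ L - 1 ≤ (2 ^ L) ^ 2` because `(2 ^ L - 1) ^ 2 ≥ 0`.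
This form also covers `L = 0`. -/
theorem card_list_length_le (L : ℕ) :
    Nat.card {l : List Bool // l.length ≤ L} ≤ 2 ^ (2 * L) := by
  let φ : {l : List Bool // l.length ≤ L} → Σ k : Fin (L + 1), List.Vector Bool k.val :=
    fun l => ⟨⟨l.1.length, Nat.lt_succ_of_le l.2⟩, ⟨l.1, rfl⟩⟩
  have hφ : Function.Injective φ := by
    intro l l' h
    have := congrArg (fun z : Σ k : Fin (L + 1), List.Vector Bool k.val => z.2.1) h
    exact Subtype.ext this
  refine (Nat.card_le_card_of_injective φ hφ).trans ?_
  have h2 : Nat.card (Σ k : Fin (L + 1), List.Vector Bool k.val) = 2 ^ (L + 1) - 1 := by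
    rw [Nat.card_eq_fintype_card, Fintype.card_sigma]
    simp only [card_vector, Fintype.card_bool]
    rw [Fin.sum_univ_eq_sum_range (fun k => 2 ^ k) (L + 1), Nat.geomSum_eq le_rfl]
    simp
  rw [h2, Nat.sub_le_iff_le_add, pow_succ, mul_comm 2 L, pow_mul]
  obtain ⟨k, hk⟩ : ∃ k, 2 ^ L = k + 1 := ⟨2 ^ L - 1, by have := Nat.one_le_two_pow (n := L); omega⟩
  rw [hk]
  nlinarith

theorem min_le_of_solvesGAR {p n m d D : ℕ} {C : Finset (Fin d → ℝ)} {a b : ℕ}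
    {M : RecurrentModel (p * (2 * n + m)) d D}
    {enc : Fin (p * (2 * n + m)) → (Fin D → ℝ) → List Bool} {L : ℕ} (hC : 2 ≤ C.card)
    (ha : 0 < a) (hb : 0 < b) (han : a ≤ n) (haC : a ≤ C.card) (hbm : b ≤ m) (hbC : b ≤ C.card)
    (hM : M.SolvesGAR C a b) (henc : M.IsBitRepresentation C a b enc)
    (hL : M.StateBitsLE C a b enc L) : min a b ≤ 2 * L * p := by
  obtain ⟨readout, hread⟩ := hM
  have hn : 0 < n := by omega
  let e : Fin C.card ↪ C := C.equivFin.symm.toEmbedding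
  -- If `b < a`, the keys beyond the first `b` are never queried; their bit is fixed to `false`.
  let ext : (Fin (min a b) → Bool) → ℕ → Bool := fun f j =>
    if h : j < min a b then f ⟨j, h⟩ else false
  let x : (Fin (min a b) → Bool) → GARInput C n m :=
    fun f => bitInput e hC ha hb haC hbC (ext f)
  have hx : ∀ f, x f ∈ garInputs C n m a b := fun f =>
    ⟨ncard_range_comp_min e ha han haC, ncard_range_comp_min e hb hbm hbC⟩
  let st : (Fin (min a b) → Bool) → Fin (p * (2 * n + m)) → Fin D → ℝ :=
    fun f i => M.state (jrpPrompt p (x f).toMatrix) i.succ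
  let Φ : (Fin (min a b) → Bool) → Fin p → {l : List Bool // l.length ≤ L} :=
    fun f r => ⟨enc (lastValueLocation hn r) (st f (lastValueLocation hn r)), hL _ (hx f) _⟩
  have hΦ : Function.Injective Φ := by
    intro f g hfg
    have hlast : ∀ r, st f (lastValueLocation hn r) = st g (lastValueLocation hn r) := fun r =>
      henc _ ⟨x f, hx f, rfl⟩ ⟨x g, hx g, rfl⟩ (congrArg Subtype.val (congrFun hfg r))
    have hstates : (fun r t => st f (queryLocation r t)) = fun r t => st g (queryLocation r t) :=
      funext fun r => funext fun t =>
        M.state_queryLocation_eq hn (x := x f) (y := x g) rfl r (hlast r) t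
    funext j
    have hj := j.isLt
    have hjm : j.val < m := by omega
    have hf := hread (x f) (hx f) ⟨j.val, hjm⟩
    have hg := hread (x g) (hx g) ⟨j.val, hjm⟩
    change (x f).IsAnswer _ (readout (fun r t => st f (queryLocation r t)) _ _) at hf
    rw [hstates] at hf
    have hq : ∀ h, (x h).query ⟨j.val, hjm⟩ = e ⟨j.val, by omega⟩ := fun h => by
      have : min j.val (b - 1) = j.val := by omega
      simp [x, bitInput, this]
    rw [hq] at hf hg
    have hfg' := bit_eq_of_isAnswer e hC ha hb haC hbC han (j := j.val) (by omega) hf hg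
    simpa only [ext, dif_pos hj] using hfg'
  have : Finite {l : List Bool // l.length ≤ L} := List.finite_length_le Bool L
  have hcard := Nat.card_le_card_of_injective Φ hΦ
  rw [Nat.card_fun, Nat.card_fun, Nat.card_eq_fintype_card (α := Bool), Fintype.card_bool,
    Nat.card_fin, Nat.card_fin] at hcard
  have hle := hcard.trans (Nat.pow_le_pow_left (card_list_length_le L) p)
  rw [← pow_mul] at hle
  exact (Nat.pow_le_pow_iff_right (by norm_num)).mp hle

theorem mainTheorem1 :
    ∃ κ : ℝ, 0 < κ ∧
      ∀ (p n m d D : ℕ) (C : Finset (Fin d → ℝ)) (a b : ℕ)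
        (M : RecurrentModel (p * (2 * n + m)) d D)
        (enc : Fin (p * (2 * n + m)) → (Fin D → ℝ) → List Bool) (L : ℕ),
        1 ≤ p →
        (∀ w ∈ C, ∀ j, w j = 0 ∨ w j = 1) →
        2 ≤ C.card →
        a ≤ n → a ≤ C.card → b ≤ m → b ≤ C.card →
        M.SolvesGAR C a b →
        M.IsBitRepresentation C a b enc →
        M.StateBitsLE C a b enc L →
        κ * ((min a b : ℕ) : ℝ) / (p : ℝ) ≤ (L : ℝ) := by
  refine ⟨1 / 2, by norm_num, ?_⟩
  intro p n m d D C a b M enc L hp _ hC han haC hbm hbC hM henc hL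
  have hmin : min a b ≤ 2 * L * p := by
    -- Clamping at `a - 1` and `b - 1` needs both positive; otherwise the bound is trivial.
    rcases Nat.eq_zero_or_pos a with rfl | ha
    · simp
    rcases Nat.eq_zero_or_pos b with rfl | hb
    · simp
    exact min_le_of_solvesGAR hC ha hb han haC hbm hbC hM henc hL
  have hreal : ((min a b : ℕ) : ℝ) ≤ 2 * L * p := by exact_mod_cast hmin
  rw [div_le_iff₀ (by exact_mod_cast hp)]
  linarith
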